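/- Let $K\subseteq\mathbf R^d$ be a non-empty closed convex set, $\Omega=\mathbf R^d\setminus K$, $\Gamma=\partial\Omega$, and let $d_H$ be the Hausdorff dimension of $\Gamma$. Let $d_\Gamma(x)=\inf_{y\in K}|x-y|$ for $x\in\Omega$, which is the Euclidean distance from $x$ to $\Gamma$. Let $\delta,\delta'\ge 0$, $c(s)=s^{\delta}(1+s)^{\delta'-\delta}$ for $s>0$, $c_\Omega=c\circ d_\Gamma$, and $\delta\wedge\delta'=\min(\delta,\delta')$. Let $p\in[1,\infty)$, assume that $d-d_H+\delta\wedge\delta'-p>0$, and put $a_p=(d-d_H+\delta\wedge\delta'-p)/p$. Then for every real-valued $\varphi\in C_c^1(\Omega)$ the following three integrals are finite and $$\int_\Omega c_\Omega\,|\nabla\varphi|^p\;\ge\;\int_\Omega c_\Omega\,|\nabla d_\Gamma\cdot\nabla\varphi|^p\;\ge\;a_p^{\,p}\int_\Omega c_\Omega\,d_\Gamma^{-p}\,|\varphi|^p ,$$ where $|\nabla\varphi|$ is the Euclidean norm of the gradient. -/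

import Mathlib

noncomputable section

/-- The distance `d_Γ(x) = inf_{y ∈ Ωᶜ} |x - y|`; for `x ∈ Ω` it is the Euclidean distance
from `x` to the boundary `Γ` of `Ω`. -/
def boundaryDist {d : ℕ} (Ω : Set (EuclideanSpace ℝ (Fin d))) (x : EuclideanSpace ℝ (Fin d)) : ℝ :=
  Metric.infDist x Ωᶜ

/-- The weight function `c(s) = s ^ δ * (1 + s) ^ (δ' - δ)`, for `s > 0`. -/
def weight (δ δ' s : ℝ) : ℝ :=
  s ^ δ * (1 + s) ^ (δ' - δ)

/-- The weight `c_Ω = c ∘ d_Γ`. -/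
def domainWeight {d : ℕ} (δ δ' : ℝ) (Ω : Set (EuclideanSpace ℝ (Fin d)))
    (x : EuclideanSpace ℝ (Fin d)) : ℝ :=
  weight δ δ' (boundaryDist Ω x)

/-- The Hausdorff dimension of the boundary of `Ω`, as a real number. The dimension of a subset
of `ℝ^d` is at most `d`, so `toReal` loses nothing. -/
def boundaryDim {d : ℕ} (Ω : Set (EuclideanSpace ℝ (Fin d))) : ℝ :=
  (dimH (frontier Ω)).toReal

/-- `φ ∈ C_c^1(Ω)`: real-valued, continuously differentiable, with compact support in `Ω`. -/
structure IsC1c {d : ℕ} (Ω : Set (EuclideanSpace ℝ (Fin d)))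
    (φ : EuclideanSpace ℝ (Fin d) → ℝ) : Prop where
  contDiff : ContDiff ℝ 1 φ
  hasCompactSupport : HasCompactSupport φ
  tsupport_subset : tsupport φ ⊆ Ω

end

/-! The first inequality holds because `d_Γ` is 1-Lipschitz. For the second, let `P` be the
nearest-point map onto `K` and `S_r x = P x + r (x - P x)`. Along a ray `d_Γ` grows linearly and `φ`
eventually vanishes, so the fundamental theorem of calculus bounds `|φ x| / d_Γ x` by `∫_1^∞
|∇d_Γ·∇φ|(S_r x) dr` (`enorm_div_infDist_le_lintegral`).

Take `p`-th powers by Jensen with density `a r^(-1-a)` and integrate against the weight. The weight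
gains at least `r^(δ∧δ')` along the ray (`weight_le_rpow_mul_weight`), and substituting `S_r` costs
at most `r^(-m)` for an integer `m ≥ d - d_H` (`lintegral_comp_rayDilation_le`). The remaining
integral in `r` gives `a^(-p)` (`lintegral_hardy_rays`).

Convexity gives the Jacobian bound: the inverse `S_(1/r)` is a contraction, with derivative `1/r` on
`m` independent directions in which `P` is locally constant (`exists_codim_directions`). -/

open MeasureTheory Module Set Filter
open scoped RealInnerProductSpace Topology NNReal ENNReal

/-! ### Nearest-point projection and dilations along its rays. -/

section Projection

variable {E : Type*} [NormedAddCommGroup E] [InnerProductSpace ℝ E] {K : Set E}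

/-- The nearest point of `K` to `x`, when `K` is nonempty, closed and convex. -/
noncomputable def convexProj (K : Set E) (x : E) : E :=
  Classical.epsilon fun q => q ∈ K ∧ ∀ k ∈ K, ⟪x - q, k - q⟫ ≤ 0

/-- Homothety with ratio `r` along the ray from the nearest point of `K` through `x`. -/
noncomputable def rayDilation (K : Set E) (r : ℝ) (x : E) : E :=
  convexProj K x + r • (x - convexProj K x)

/-- Sum of the two variational inequalities. It yields uniqueness of the nearest point (`x = y`)
and, by Cauchy–Schwarz, that the projection is nonexpansive. -/
lemma eq_of_inner_sub_nonpos {x y p q : E} (h₁ : ⟪x - p, q - p⟫ ≤ 0) (h₂ : ⟪y - q, p - q⟫ ≤ 0) :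
    ‖p - q‖ ^ 2 ≤ ⟪x - y, p - q⟫ := by
  rw [← real_inner_self_eq_norm_sq]
  simp only [inner_sub_left, inner_sub_right] at *
  linarith [real_inner_comm p q, real_inner_comm x y]

lemma convexProj_spec [CompleteSpace E] (hne : K.Nonempty) (hc : IsClosed K) (hK : Convex ℝ K)
    (x : E) : convexProj K x ∈ K ∧ ∀ k ∈ K, ⟪x - convexProj K x, k - convexProj K x⟫ ≤ 0 := by
  apply Classical.epsilon_spec (p := fun q => q ∈ K ∧ ∀ k ∈ K, ⟪x - q, k - q⟫ ≤ 0)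
  obtain ⟨v, hv, h⟩ := exists_norm_eq_iInf_of_complete_convex hne hc.isComplete hK x
  exact ⟨v, hv, (norm_eq_iInf_iff_real_inner_le_zero hK hv).1 h⟩

lemma convexProj_eq {x q : E} (hq : q ∈ K) (h : ∀ k ∈ K, ⟪x - q, k - q⟫ ≤ 0) :
    convexProj K x = q := by
  have hs := Classical.epsilon_spec (p := fun q => q ∈ K ∧ ∀ k ∈ K, ⟪x - q, k - q⟫ ≤ 0) ⟨q, hq, h⟩
  have := eq_of_inner_sub_nonpos (hs.2 q hq) (h _ hs.1)
  rw [sub_self, inner_zero_left] at this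
  have h0 := pow_eq_zero_iff (two_ne_zero) |>.1 (le_antisymm this (sq_nonneg _))
  exact sub_eq_zero.1 (norm_eq_zero.1 h0)

lemma rayDilation_one (x : E) : rayDilation K 1 x = x := by simp [rayDilation]

/-- Moving along a direction in which the projection is locally constant, `rayDilation K s` is
a homothety to first order. -/
lemma fderiv_rayDilation_apply {s : ℝ} {x w : E}
    (hw : ∀ᶠ t : ℝ in 𝓝 0, convexProj K (x + t • w) = convexProj K x)
    (hd : DifferentiableAt ℝ (rayDilation K s) x) : fderiv ℝ (rayDilation K s) x w = s • w := by
  have h1 : HasDerivAt (fun t : ℝ => rayDilation K s (x + t • w))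
      (fderiv ℝ (rayDilation K s) x w) 0 :=
    hd.hasFDerivAt.hasLineDerivAt w
  have h2 : HasDerivAt (fun t : ℝ => rayDilation K s x + t • s • w) (s • w) 0 := by
    simpa using ((hasDerivAt_id (0 : ℝ)).smul_const (s • w)).const_add (rayDilation K s x)
  refine h1.unique (h2.congr_of_eventuallyEq ?_)
  filter_upwards [hw] with t ht
  simp only [rayDilation, ht]
  module

variable [CompleteSpace E]

lemma lipschitzWith_convexProj (hne : K.Nonempty) (hc : IsClosed K) (hK : Convex ℝ K) :
    LipschitzWith 1 (convexProj K) := by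
  refine LipschitzWith.of_dist_le_mul fun x y => ?_
  have hx := convexProj_spec hne hc hK x
  have hy := convexProj_spec hne hc hK y
  have h := eq_of_inner_sub_nonpos (hx.2 _ hy.1) (hy.2 _ hx.1)
  have h2 := h.trans (real_inner_le_norm _ _)
  rw [dist_eq_norm, dist_eq_norm, NNReal.coe_one, one_mul]
  by_contra! hlt
  nlinarith [norm_nonneg (x - y)]

lemma continuous_convexProj (hne : K.Nonempty) (hc : IsClosed K) (hK : Convex ℝ K) :
    Continuous (convexProj K) := (lipschitzWith_convexProj hne hc hK).continuous

lemma infDist_eq_norm_sub_convexProj (hne : K.Nonempty) (hc : IsClosed K) (hK : Convex ℝ K)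
    (x : E) : Metric.infDist x K = ‖x - convexProj K x‖ := by
  have hs := convexProj_spec hne hc hK x
  rw [(norm_eq_iInf_iff_real_inner_le_zero hK hs.1).2 hs.2, Metric.infDist_eq_iInf]
  simp only [dist_eq_norm]

lemma convexProj_rayDilation (hne : K.Nonempty) (hc : IsClosed K) (hK : Convex ℝ K)
    {r : ℝ} (hr : 0 ≤ r) (x : E) : convexProj K (rayDilation K r x) = convexProj K x := by
  have hs := convexProj_spec hne hc hK x
  refine convexProj_eq hs.1 fun k hk => ?_
  rw [rayDilation, add_sub_cancel_left, inner_smul_left]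
  exact mul_nonpos_of_nonneg_of_nonpos hr (hs.2 k hk)

lemma rayDilation_sub_convexProj (hne : K.Nonempty) (hc : IsClosed K) (hK : Convex ℝ K)
    {r : ℝ} (hr : 0 ≤ r) (x : E) :
    rayDilation K r x - convexProj K (rayDilation K r x) = r • (x - convexProj K x) := by
  rw [convexProj_rayDilation hne hc hK hr, rayDilation, add_sub_cancel_left]

lemma rayDilation_rayDilation (hne : K.Nonempty) (hc : IsClosed K) (hK : Convex ℝ K)
    {r : ℝ} (hr : 0 ≤ r) (s : ℝ) (x : E) :
    rayDilation K s (rayDilation K r x) = rayDilation K (s * r) x := by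
  rw [rayDilation, rayDilation_sub_convexProj hne hc hK hr, convexProj_rayDilation hne hc hK hr,
    smul_smul, rayDilation]

lemma infDist_rayDilation (hne : K.Nonempty) (hc : IsClosed K) (hK : Convex ℝ K)
    {r : ℝ} (hr : 0 ≤ r) (x : E) :
    Metric.infDist (rayDilation K r x) K = r * Metric.infDist x K := by
  rw [infDist_eq_norm_sub_convexProj hne hc hK, rayDilation_sub_convexProj hne hc hK hr, norm_smul,
    infDist_eq_norm_sub_convexProj hne hc hK, Real.norm_of_nonneg hr]

lemma rayDilation_notMem (hne : K.Nonempty) (hc : IsClosed K) (hK : Convex ℝ K)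
    {r : ℝ} (hr : 0 < r) {x : E} (hx : x ∉ K) : rayDilation K r x ∉ K := by
  rw [hc.notMem_iff_infDist_pos hne] at *
  rw [infDist_rayDilation hne hc hK hr.le]
  positivity

lemma lipschitzWith_rayDilation (hne : K.Nonempty) (hc : IsClosed K) (hK : Convex ℝ K)
    {s : ℝ} (h0 : 0 ≤ s) (h1 : s ≤ 1) : LipschitzWith 1 (rayDilation K s) := by
  refine LipschitzWith.of_dist_le_mul fun x y => ?_
  have h := (lipschitzWith_convexProj hne hc hK).dist_le_mul x y
  rw [dist_eq_norm, dist_eq_norm, NNReal.coe_one, one_mul] at *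
  -- For `s` in `[0, 1]` the dilation is a convex combination of two nonexpansive maps, the
  -- projection and the identity.
  have : rayDilation K s x - rayDilation K s y =
      (1 - s) • (convexProj K x - convexProj K y) + s • (x - y) := by
    simp only [rayDilation]; module
  rw [this]
  refine (norm_add_le _ _).trans ?_
  rw [norm_smul, norm_smul, Real.norm_of_nonneg h0, Real.norm_of_nonneg (by linarith)]
  nlinarith [norm_nonneg (x - y)]

lemma convexProj_add_smul_of_mem_orthogonal (hne : K.Nonempty) (hc : IsClosed K)
    (hK : Convex ℝ K) {x w : E} (hw : w ∈ (vectorSpan ℝ K)ᗮ) (t : ℝ) :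
    convexProj K (x + t • w) = convexProj K x := by
  have hs := convexProj_spec hne hc hK x
  refine convexProj_eq hs.1 fun k hk => ?_
  have h0 : ⟪w, k - convexProj K x⟫ = 0 :=
    (Submodule.mem_orthogonal' _ _).1 hw _ (vsub_mem_vectorSpan ℝ hk hs.1)
  rw [add_sub_right_comm, inner_add_left, inner_smul_left, h0]
  simpa using hs.2 k hk

lemma convexProj_add_smul_sub_convexProj (hne : K.Nonempty) (hc : IsClosed K)
    (hK : Convex ℝ K) (x : E) {t : ℝ} (ht : -1 ≤ t) :
    convexProj K (x + t • (x - convexProj K x)) = convexProj K x := by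
  have h := convexProj_rayDilation hne hc hK (by linarith : 0 ≤ 1 + t) x
  rwa [rayDilation, add_smul, one_smul, ← add_assoc, add_sub_cancel] at h

end Projection

/-! ### Hausdorff dimension of the frontier and directions that fix the projection. -/

section Dimension

variable {E : Type*} [NormedAddCommGroup E] [InnerProductSpace ℝ E] [FiniteDimensional ℝ E]
  {K : Set E}

/-- Every segment parallel and close to one joining an interior point `z` to an outside point `x`
crosses the frontier. Hence the orthogonal projection of the frontier to the hyperplane `(x - z)ᗮ`
contains a neighbourhood, and projecting does not raise dimension. -/
lemma finrank_sub_one_le_dimH_frontier (hc : IsClosed K) (hi : (interior K).Nonempty)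
    (hu : K ≠ univ) : (finrank ℝ E : ℝ≥0∞) ≤ dimH (frontier K) + 1 := by
  obtain ⟨z, hz⟩ := hi
  obtain ⟨x, hx⟩ := (ne_univ_iff_exists_notMem K).1 hu
  have hzx : x - z ≠ 0 := by
    intro h
    rw [sub_eq_zero.1 h] at hx
    exact hx (interior_subset hz)
  set U : Submodule ℝ E := (ℝ ∙ (x - z))ᗮ with hU
  have hev : ∀ᶠ v : U in 𝓝 0, z + (v : E) ∈ K ∧ x + (v : E) ∉ K := by
    have h1 : Tendsto (fun v : U => z + (v : E)) (𝓝 0) (𝓝 z) := by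
      have : Continuous (fun v : U => z + (v : E)) := by fun_prop
      simpa using this.tendsto 0
    have h2 : Tendsto (fun v : U => x + (v : E)) (𝓝 0) (𝓝 x) := by
      have : Continuous (fun v : U => x + (v : E)) := by fun_prop
      simpa using this.tendsto 0
    exact (h1.eventually (mem_interior_iff_mem_nhds.1 hz)).and
      (h2.eventually (hc.isOpen_compl.mem_nhds hx))
  have hsub : ∀ v : U, z + (v : E) ∈ K ∧ x + (v : E) ∉ K →
      U.orthogonalProjectionOnto z + v ∈ U.orthogonalProjectionOnto '' frontier K := by
    rintro v ⟨h1, h2⟩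
    let f : ℝ → E := fun t => z + v + t • (x - z)
    have hf : Continuous f := by fun_prop
    have hT : (frontier (f ⁻¹' K)).Nonempty := by
      rw [nonempty_frontier_iff]
      refine ⟨⟨0, by simpa [f] using h1⟩, (ne_univ_iff_exists_notMem _).2 ⟨1, ?_⟩⟩
      have : f 1 = x + v := by simp only [f]; module
      rwa [mem_preimage, this]
    obtain ⟨t, ht⟩ := hT
    refine ⟨f t, hf.frontier_preimage_subset K ht, ?_⟩
    have hp : U.orthogonalProjectionOnto (x - z) = 0 := by
      rw [Submodule.orthogonalProjectionOnto_eq_zero_iff, hU, Submodule.orthogonal_orthogonal]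
      exact Submodule.mem_span_singleton_self _
    simp only [f, map_add, map_smul, hp, smul_zero, add_zero,
      Submodule.orthogonalProjectionOnto_mem_subspace_eq_self]
  have hnhds : U.orthogonalProjectionOnto '' frontier K ∈ 𝓝 (U.orthogonalProjectionOnto z) := by
    have h0 : Tendsto (fun y : U => y - U.orthogonalProjectionOnto z)
        (𝓝 (U.orthogonalProjectionOnto z)) (𝓝 0) := by
      have : Continuous (fun y : U => y - U.orthogonalProjectionOnto z) := by fun_prop
      simpa using this.tendsto (U.orthogonalProjectionOnto z)
    filter_upwards [h0.eventually hev] with y hy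
    simpa using hsub _ hy
  have h1 := Real.dimH_of_mem_nhds hnhds
  have h2 : finrank ℝ U + 1 = finrank ℝ E := by
    have := Submodule.finrank_add_finrank_orthogonal (ℝ ∙ (x - z))
    rw [finrank_span_singleton hzx] at this
    rw [hU]; omega
  rw [← h2, Nat.cast_add, ← h1, Nat.cast_one]
  gcongr
  exact dimH_orthogonalProjectionOnto_le U _

/-- Off `K` there are at least `dim E - dimH (frontier K)` independent directions along which
the nearest point of `K` does not move. -/
lemma exists_codim_directions (hne : K.Nonempty) (hc : IsClosed K) (hK : Convex ℝ K)
    (hu : K ≠ univ) :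
    ∃ m : ℕ, (finrank ℝ E : ℝ) - (dimH (frontier K)).toReal ≤ m ∧
      ∀ x ∉ K, ∃ W : Submodule ℝ E, finrank ℝ W = m ∧
        ∀ w ∈ W, ∀ᶠ t : ℝ in 𝓝 0, convexProj K (x + t • w) = convexProj K x := by
  -- With interior points the frontier has dimension at least `dim E - 1`, so the ray direction
  -- alone suffices. Otherwise the frontier is `K`, whose dimension is that of its affine span, and
  -- the orthogonal directions have the right number.
  by_cases hi : (interior K).Nonempty
  · refine ⟨1, ?_, fun x hx => ⟨ℝ ∙ (x - convexProj K x), ?_, fun w hw => ?_⟩⟩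
    · have h := finrank_sub_one_le_dimH_frontier hc hi hu
      have h' := ENNReal.toReal_mono
        (ENNReal.add_ne_top.2 ⟨Real.dimH_ne_top (frontier K), ENNReal.one_ne_top⟩) h
      rw [ENNReal.toReal_add (Real.dimH_ne_top _) ENNReal.one_ne_top] at h'
      simp only [ENNReal.toReal_natCast, ENNReal.toReal_one] at h'
      push_cast
      linarith
    · refine finrank_span_singleton fun h => hx ?_
      rw [sub_eq_zero.1 h]
      exact (convexProj_spec hne hc hK x).1
    · obtain ⟨c, rfl⟩ := Submodule.mem_span_singleton.1 hw
      have h0 : Tendsto (fun t : ℝ => t * c) (𝓝 0) (𝓝 0) := by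
        have : Continuous (fun t : ℝ => t * c) := by fun_prop
        simpa using this.tendsto 0
      filter_upwards [h0.eventually (lt_mem_nhds (by norm_num : (-1 : ℝ) < 0))] with t ht
      rw [smul_smul]
      exact convexProj_add_smul_sub_convexProj hne hc hK x ht.le
  · refine ⟨finrank ℝ (vectorSpan ℝ K)ᗮ, ?_, fun x _ => ⟨_, rfl, fun w hw => ?_⟩⟩
    · have hf : frontier K = K := by
        rw [hc.frontier_eq, not_nonempty_iff_eq_empty.1 hi, sdiff_empty]
      rw [hf, Real.Convex.dimH_eq_finrank_vectorSpan hK hne, ENNReal.toReal_natCast,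
        ← Submodule.finrank_add_finrank_orthogonal (vectorSpan ℝ K)]
      push_cast
      linarith
    · exact Eventually.of_forall fun t => convexProj_add_smul_of_mem_orthogonal hne hc hK hw t

end Dimension

/-! ### Volume distortion of the dilations. -/

section Volume

variable {E : Type*} [NormedAddCommGroup E] [InnerProductSpace ℝ E] [FiniteDimensional ℝ E]

/-- Hadamard's inequality for the determinant of an endomorphism. -/
lemma abs_det_le_prod_norm {E : Type*} [NormedAddCommGroup E] [InnerProductSpace ℝ E] {n : ℕ} (b : OrthonormalBasis (Fin n) ℝ E) (L : E →ₗ[ℝ] E) :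
    |LinearMap.det L| ≤ ∏ i, ‖L (b i)‖ := by
  have : Fact (finrank ℝ E = n) := ⟨by rw [finrank_eq_card_basis b.toBasis, Fintype.card_fin]⟩
  have h := (b.toBasis.orientation).abs_volumeForm_apply_le (fun i => L (b i))
  rw [Orientation.volumeForm_robust _ b rfl] at h
  have h2 := b.toBasis.det_comp L b
  rw [← b.coe_toBasis, b.toBasis.det_self, mul_one] at h2
  rw [← h2]
  simpa [Function.comp_def] using h

/-- Hadamard's inequality in an orthonormal basis extending one of `W`: each vector of `W`
contributes `s`, every other at most `1`. -/
lemma abs_det_le_pow_finrank {L : E →L[ℝ] E} (hL : ‖L‖ ≤ 1) {s : ℝ} (h0 : 0 ≤ s)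
    {W : Submodule ℝ E} (hW : ∀ w ∈ W, L w = s • w) : |L.det| ≤ s ^ finrank ℝ W := by
  let ι := Fin (finrank ℝ W) ⊕ Fin (finrank ℝ Wᗮ)
  have hcard : finrank ℝ E = Fintype.card ι := by
    simp [ι, Submodule.finrank_add_finrank_orthogonal]
  let v : ι → E := Sum.elim (fun i => (stdOrthonormalBasis ℝ W i : E)) 0
  have hv : Orthonormal ℝ ((range (Sum.inl : _ → ι)).domRestrict v) := by
    have h := (stdOrthonormalBasis ℝ W).orthonormal.comp_linearIsometry W.subtypeₗᵢ
    constructor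
    · rintro ⟨_, i, rfl⟩
      exact h.1 i
    · rintro ⟨_, i, rfl⟩ ⟨_, j, rfl⟩ hij
      exact h.2 (fun h => hij (by rw [h]))
  obtain ⟨b, hb⟩ := hv.exists_orthonormalBasis_extension_of_card_eq hcard
  have h := abs_det_le_prod_norm (b.reindex finSumFinEquiv) L.toLinearMap
  rw [← finSumFinEquiv.prod_comp] at h
  simp only [OrthonormalBasis.reindex_apply, Equiv.symm_apply_apply, Fintype.prod_sum_type] at h
  refine h.trans ?_
  have h1 : ∀ i, ‖L (b (Sum.inl i))‖ = s := fun i => by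
    have hi : L (v (Sum.inl i)) = s • v (Sum.inl i) := hW _ (stdOrthonormalBasis ℝ W i).2
    have hn : ‖v (Sum.inl i)‖ = 1 := (stdOrthonormalBasis ℝ W).orthonormal.1 i
    rw [hb _ ⟨i, rfl⟩, hi, norm_smul, Real.norm_of_nonneg h0, hn, mul_one]
  have h2 : ∀ i, ‖L (b (Sum.inr i))‖ ≤ 1 := fun i => by
    simpa using L.le_of_opNorm_le hL (b (Sum.inr i))
  have h3 : ∏ i, ‖L (b (Sum.inr i))‖ ≤ 1 :=
    Finset.prod_le_one (fun i _ => norm_nonneg _) fun i _ => h2 i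
  have h4 : ∏ i, ‖L (b (Sum.inl i))‖ = s ^ finrank ℝ W := by simp [h1]
  change (∏ i, ‖L (b (Sum.inl i))‖) * ∏ i, ‖L (b (Sum.inr i))‖ ≤ _
  rw [h4]
  exact mul_le_of_le_one_right (pow_nonneg h0 _) h3

lemma continuous_rayDilation {K : Set E} (hne : K.Nonempty) (hc : IsClosed K)
    (hK : Convex ℝ K) : Continuous fun z : E × ℝ => rayDilation K z.2 z.1 := by
  have := continuous_convexProj hne hc hK
  unfold rayDilation
  fun_prop

variable [MeasurableSpace E] [BorelSpace E] (μ : Measure E) [μ.IsAddHaarMeasure]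

lemma LipschitzWith.addHaar_image_eq_zero {C : ℝ≥0} {f : E → E} (hf : LipschitzWith C f)
    {A : Set E} (hA : μ A = 0) : μ (f '' A) = 0 := by
  have h1 : μ ≪ μH[finrank ℝ E] := Measure.absolutelyContinuous_isAddHaarMeasure _ _
  have h2 : (μH[finrank ℝ E] : Measure E) ≪ μ := Measure.absolutelyContinuous_isAddHaarMeasure _ _
  refine h1 (le_antisymm ?_ zero_le)
  refine (hf.hausdorffMeasure_image_le (Nat.cast_nonneg _) A).trans ?_
  rw [h2 hA, mul_zero]

/-- By Rademacher the non-differentiability points form a null set, which a Lipschitz map sends to a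
null set. Elsewhere the Jacobian is at most `s ^ m`. -/
lemma addHaar_rayDilation_image_le {K : Set E} (hne : K.Nonempty) (hc : IsClosed K)
    (hK : Convex ℝ K) {m : ℕ}
    (hm : ∀ x ∉ K, ∃ W : Submodule ℝ E, finrank ℝ W = m ∧
        ∀ w ∈ W, ∀ᶠ t : ℝ in 𝓝 0, convexProj K (x + t • w) = convexProj K x)
    {s : ℝ} (h0 : 0 ≤ s) (h1 : s ≤ 1) {A : Set E} (hA : MeasurableSet A) (hAK : A ⊆ Kᶜ) :
    μ (rayDilation K s '' A) ≤ ENNReal.ofReal (s ^ m) * μ A := by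
  have hlip := lipschitzWith_rayDilation hne hc hK h0 h1
  set D := {x | DifferentiableAt ℝ (rayDilation K s) x}
  have hD : MeasurableSet D := measurableSet_of_differentiableAt ℝ _
  have hnull : μ (rayDilation K s '' (A \ D)) = 0 :=
    hlip.addHaar_image_eq_zero μ
      (measure_mono_null (fun x hx => hx.2) (hlip.ae_differentiableAt (μ := μ)))
  have hdiff : μ (rayDilation K s '' (A ∩ D)) ≤ ENNReal.ofReal (s ^ m) * μ A := by
    refine (addHaar_image_le_lintegral_abs_det_fderiv μ (hA.inter hD)
      (fun x hx => hx.2.hasFDerivAt.hasFDerivWithinAt)).trans ?_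
    refine (setLIntegral_mono' (hA.inter hD) (g := fun _ => ENNReal.ofReal (s ^ m))
      fun x hx => ENNReal.ofReal_le_ofReal ?_).trans ?_
    · obtain ⟨W, rfl, hW⟩ := hm x (hAK hx.1)
      exact abs_det_le_pow_finrank (by simpa using norm_fderiv_le_of_lipschitz ℝ hlip) h0
        fun w hw => fderiv_rayDilation_apply (hW w hw) hx.2
    · rw [setLIntegral_const]
      gcongr
      exact inter_subset_left
  calc μ (rayDilation K s '' A)
      = μ (rayDilation K s '' (A ∩ D) ∪ rayDilation K s '' (A \ D)) := by
        rw [← image_union, inter_union_sdiff]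
    _ ≤ _ := (measure_union_le _ _).trans (by rw [hnull, add_zero]; exact hdiff)

lemma lintegral_comp_rayDilation_le {K : Set E} (hne : K.Nonempty) (hc : IsClosed K)
    (hK : Convex ℝ K) {m : ℕ}
    (hm : ∀ x ∉ K, ∃ W : Submodule ℝ E, finrank ℝ W = m ∧
        ∀ w ∈ W, ∀ᶠ t : ℝ in 𝓝 0, convexProj K (x + t • w) = convexProj K x)
    {r : ℝ} (hr : 1 ≤ r) {h : E → ℝ≥0∞} (hh : Measurable h) :
    ∫⁻ x in Kᶜ, h (rayDilation K r x) ∂μ ≤ ENNReal.ofReal (r⁻¹ ^ m) * ∫⁻ x in Kᶜ, h x ∂μ := by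
  have hr0 : 0 < r := by linarith
  have hcont : Continuous (rayDilation K r) :=
    (continuous_rayDilation hne hc hK).comp (Continuous.prodMk_left r)
  rw [← lintegral_map hh hcont.measurable, ← smul_eq_mul, ← lintegral_smul_measure]
  refine lintegral_mono' (Measure.le_iff.2 fun A hA => ?_) le_rfl
  rw [Measure.map_apply hcont.measurable hA, Measure.smul_apply, smul_eq_mul,
    Measure.restrict_apply (hcont.measurable hA), Measure.restrict_apply hA]
  -- The preimage under ratio `r` lies in the image under the contraction of ratio `r⁻¹`.
  refine (measure_mono ?_).trans (addHaar_rayDilation_image_le μ hne hc hK hm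
    (inv_nonneg.2 hr0.le) (inv_le_one_of_one_le₀ hr) (hA.inter hc.measurableSet.compl)
    inter_subset_right)
  rintro x ⟨hxA, hxK⟩
  refine ⟨rayDilation K r x, ⟨hxA, rayDilation_notMem hne hc hK hr0 hxK⟩, ?_⟩
  rw [rayDilation_rayDilation hne hc hK hr0.le, inv_mul_cancel₀ hr0.ne', rayDilation_one]

end Volume

/-! ### The Hardy inequality along rays. -/

section Hardy

lemma lintegral_Ioi_one_rpow {a : ℝ} (ha : 0 < a) :
    ∫⁻ r in Ioi (1 : ℝ), ENNReal.ofReal (r ^ (-(1 + a))) = ENNReal.ofReal a⁻¹ := by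
  rw [← ofReal_integral_eq_lintegral_ofReal
    (integrableOn_Ioi_rpow_of_lt (by linarith) zero_lt_one)]
  · rw [integral_Ioi_rpow_of_lt (by linarith) zero_lt_one, Real.one_rpow]
    congr 1
    rw [show -(1 + a) + 1 = -a by ring, neg_div_neg_eq, one_div]
  · filter_upwards [self_mem_ae_restrict measurableSet_Ioi] with r hr
    exact Real.rpow_nonneg (zero_le_one.trans (le_of_lt hr)) _

lemma rpow_lintegral_le_lintegral_rpow {α : Type*} [MeasurableSpace α] (ν : Measure α)
    [IsProbabilityMeasure ν] {f : α → ℝ≥0∞} (hf : Measurable f) {p : ℝ} (hp : 1 ≤ p) :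
    (∫⁻ x, f x ∂ν) ^ p ≤ ∫⁻ x, f x ^ p ∂ν := by
  have hp0 : 0 < p := by linarith
  have h := eLpNorm_le_eLpNorm_of_exponent_le (μ := ν) (f := f)
    (p := 1) (q := ENNReal.ofReal p) (by simpa using hp) hf.aestronglyMeasurable
  rw [eLpNorm_one_eq_lintegral_enorm, eLpNorm_eq_lintegral_rpow_enorm_toReal
    (by simpa using hp0) ENNReal.ofReal_ne_top, ENNReal.toReal_ofReal hp0.le] at h
  simp only [enorm_eq_self] at h
  calc (∫⁻ x, f x ∂ν) ^ p ≤ ((∫⁻ x, f x ^ p ∂ν) ^ (1 / p)) ^ p := by gcongr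
    _ = _ := by rw [← ENNReal.rpow_mul, one_div_mul_cancel hp0.ne', ENNReal.rpow_one]

/-- Jensen's inequality for the probability density `a * r ^ (-(1 + a))` on `(1, ∞)`. -/
lemma rpow_lintegral_Ioi_le {a p : ℝ} (ha : 0 < a) (hp : 1 ≤ p) {u : ℝ → ℝ≥0∞}
    (hu : Measurable u) :
    (∫⁻ r in Ioi (1 : ℝ), u r) ^ p ≤
      ∫⁻ r in Ioi (1 : ℝ), ENNReal.ofReal (a ^ (1 - p) * r ^ ((1 + a) * (p - 1))) * u r ^ p := by
  set ρ : ℝ → ℝ≥0∞ := fun r => ENNReal.ofReal (a * r ^ (-(1 + a))) with hρ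
  have hρm : Measurable ρ := by fun_prop
  set ν := (volume.restrict (Ioi (1 : ℝ))).withDensity ρ with hν
  have hprob : IsProbabilityMeasure ν := by
    refine ⟨?_⟩
    rw [hν, withDensity_apply _ MeasurableSet.univ, Measure.restrict_univ]
    simp only [hρ, ENNReal.ofReal_mul ha.le]
    rw [lintegral_const_mul _ (by fun_prop), lintegral_Ioi_one_rpow ha, ← ENNReal.ofReal_mul ha.le,
      mul_inv_cancel₀ ha.ne', ENNReal.ofReal_one]
  -- This is `u` divided by the density, so its `ν`-mean is the integral of `u`.
  set f : ℝ → ℝ≥0∞ := fun r => ENNReal.ofReal (a⁻¹ * r ^ (1 + a)) * u r with hf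
  have hfm : Measurable f := by fun_prop
  have h := rpow_lintegral_le_lintegral_rpow ν hfm hp
  rw [hν, lintegral_withDensity_eq_lintegral_mul _ hρm hfm,
    lintegral_withDensity_eq_lintegral_mul _ hρm (by fun_prop)] at h
  have hl : ∫⁻ r in Ioi (1 : ℝ), u r = ∫⁻ r in Ioi (1 : ℝ), (ρ * f) r := by
    refine setLIntegral_congr_fun measurableSet_Ioi fun r hr => ?_
    have hr0 : 0 < r := zero_lt_one.trans hr
    simp only [Pi.mul_apply, hρ, hf]
    rw [← mul_assoc, ← ENNReal.ofReal_mul (by positivity), mul_mul_mul_comm, mul_inv_cancel₀ ha.ne',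
      ← Real.rpow_add hr0, neg_add_cancel, Real.rpow_zero, mul_one, ENNReal.ofReal_one, one_mul]
  have hr : ∫⁻ r in Ioi (1 : ℝ), ENNReal.ofReal (a ^ (1 - p) * r ^ ((1 + a) * (p - 1))) * u r ^ p =
      ∫⁻ r in Ioi (1 : ℝ), (ρ * fun r => f r ^ p) r := by
    refine setLIntegral_congr_fun measurableSet_Ioi fun r hr => ?_
    have hr0 : 0 < r := zero_lt_one.trans hr
    simp only [Pi.mul_apply, hρ, hf]
    rw [ENNReal.mul_rpow_of_nonneg _ _ (by linarith),
      ENNReal.ofReal_rpow_of_pos (by positivity), ← mul_assoc, ← ENNReal.ofReal_mul (by positivity),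
      Real.mul_rpow (by positivity) (by positivity), mul_mul_mul_comm, Real.inv_rpow ha.le,
      ← Real.rpow_neg ha.le, ← Real.rpow_mul hr0.le, ← Real.rpow_add hr0,
      Real.rpow_sub ha, Real.rpow_one, Real.rpow_neg ha.le, div_eq_mul_inv]
    congr 4
    ring
  rwa [hl, hr]

variable {E : Type*} [NormedAddCommGroup E] [InnerProductSpace ℝ E] [FiniteDimensional ℝ E]
  [MeasurableSpace E] [BorelSpace E] (μ : Measure E) [μ.IsAddHaarMeasure]

/-- The weighted Hardy inequality for functions dominated by integrals along the rays leaving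
a convex set. -/
lemma lintegral_hardy_rays {K : Set E} (hne : K.Nonempty) (hc : IsClosed K)
    (hK : Convex ℝ K) {m : ℕ}
    (hm : ∀ x ∉ K, ∃ W : Submodule ℝ E, finrank ℝ W = m ∧
        ∀ w ∈ W, ∀ᶠ t : ℝ in 𝓝 0, convexProj K (x + t • w) = convexProj K x)
    {a p κ : ℝ} (ha : 0 < a) (hp : 1 ≤ p) (hκ : (1 + a) * p ≤ m + κ)
    {w g F : E → ℝ≥0∞} (hw : Measurable w) (hg : Measurable g)
    (hwr : ∀ x, ∀ r : ℝ, 1 ≤ r → w x ≤ ENNReal.ofReal (r ^ (-κ)) * w (rayDilation K r x))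
    (hF : ∀ x ∉ K, F x ≤ ∫⁻ r in Ioi (1 : ℝ), g (rayDilation K r x)) :
    ∫⁻ x in Kᶜ, w x * F x ^ p ∂μ ≤
      ENNReal.ofReal (a ^ (-p)) * ∫⁻ x in Kᶜ, w x * g x ^ p ∂μ := by
  have hS := (continuous_rayDilation hne hc hK).measurable
  have hS' : ∀ r, Measurable (rayDilation K r) := fun r => hS.comp measurable_prodMk_right
  set ψ : ℝ → ℝ≥0∞ := fun r => ENNReal.ofReal (a ^ (1 - p) * r ^ ((1 + a) * (p - 1))) with hψ
  have hψm : Measurable ψ := by fun_prop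
  set I := ∫⁻ x in Kᶜ, w x * g x ^ p ∂μ with hI
  calc ∫⁻ x in Kᶜ, w x * F x ^ p ∂μ
      ≤ ∫⁻ x in Kᶜ, (∫⁻ r in Ioi (1 : ℝ), w x * (ψ r * g (rayDilation K r x) ^ p)) ∂μ := by
        refine setLIntegral_mono' hc.measurableSet.compl fun x hx => ?_
        have hgx : Measurable fun r => g (rayDilation K r x) :=
          hg.comp (hS.comp measurable_prodMk_left)
        have hm' : Measurable fun r => ψ r * g (rayDilation K r x) ^ p :=
          hψm.mul (hgx.pow_const p)
        rw [lintegral_const_mul _ hm']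
        gcongr
        refine (ENNReal.rpow_le_rpow (hF x hx) (by linarith)).trans ?_
        exact rpow_lintegral_Ioi_le ha hp hgx
    _ = ∫⁻ r in Ioi (1 : ℝ), ∫⁻ x in Kᶜ, w x * (ψ r * g (rayDilation K r x) ^ p) ∂μ := by
        apply lintegral_lintegral_swap
        have hgS : Measurable fun z : E × ℝ => g (rayDilation K z.2 z.1) := hg.comp hS
        unfold Function.uncurry
        fun_prop
    _ ≤ ∫⁻ r in Ioi (1 : ℝ),
          ENNReal.ofReal (a ^ (1 - p)) * I * ENNReal.ofReal (r ^ (-(1 + a))) := by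
        refine setLIntegral_mono' measurableSet_Ioi fun r hr => ?_
        have hr1 : 1 ≤ r := le_of_lt hr
        have hr0 : 0 < r := zero_lt_one.trans hr
        calc ∫⁻ x in Kᶜ, w x * (ψ r * g (rayDilation K r x) ^ p) ∂μ
            ≤ ∫⁻ x in Kᶜ, ψ r * ENNReal.ofReal (r ^ (-κ)) *
                (w (rayDilation K r x) * g (rayDilation K r x) ^ p) ∂μ := by
              refine lintegral_mono fun x => ?_
              refine (mul_le_mul_left (hwr x r hr1) _).trans (le_of_eq ?_)
              ring
          _ = ψ r * ENNReal.ofReal (r ^ (-κ)) * ∫⁻ x in Kᶜ,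
                (fun y => w y * g y ^ p) (rayDilation K r x) ∂μ := by
              have := hS' r
              rw [lintegral_const_mul _ (by fun_prop)]
          _ ≤ ψ r * ENNReal.ofReal (r ^ (-κ)) * (ENNReal.ofReal (r⁻¹ ^ m) * I) := by
              gcongr
              exact lintegral_comp_rayDilation_le μ hne hc hK hm hr1 (by fun_prop)
          _ = ENNReal.ofReal (a ^ (1 - p) * r ^ ((1 + a) * (p - 1) + -κ + -m)) * I := by
              rw [← mul_assoc, hψ, ← ENNReal.ofReal_mul (by positivity),
                ← ENNReal.ofReal_mul (by positivity), Real.rpow_add hr0, Real.rpow_add hr0,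
                Real.rpow_neg hr0.le (m : ℝ), Real.rpow_natCast, inv_pow]
              ring_nf
          -- The comparison of exponents is `hκ` rearranged, with base `r ≥ 1`.
          _ ≤ ENNReal.ofReal (a ^ (1 - p) * r ^ (-(1 + a))) * I := by
              gcongr
              linarith
          _ = _ := by
              rw [ENNReal.ofReal_mul (by positivity)]
              ring
    _ = ENNReal.ofReal (a ^ (-p)) * I := by
        rw [lintegral_const_mul _ (by fun_prop), lintegral_Ioi_one_rpow ha, mul_right_comm,
          ← ENNReal.ofReal_mul (by positivity), ← Real.rpow_neg_one a, ← Real.rpow_add ha]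
        congr 3
        ring

end Hardy

/-- The factor `s ^ δ` scales exactly. The other factor is nondecreasing in `s` if `δ ≤ δ'`;
otherwise `1 + r s ≤ r (1 + s)` bounds its loss by `r ^ (δ - δ')`. -/
lemma weight_le_rpow_mul_weight {δ δ' r s : ℝ} (hr : 1 ≤ r) (hs : 0 ≤ s) :
    weight δ δ' s ≤ r ^ (-min δ δ') * weight δ δ' (r * s) := by
  have hr0 : 0 < r := by linarith
  unfold weight
  rw [Real.mul_rpow hr0.le hs]
  suffices h : (1 + s) ^ (δ' - δ) ≤ r ^ (δ - min δ δ') * (1 + r * s) ^ (δ' - δ) by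
    calc _ ≤ s ^ δ * (r ^ (δ - min δ δ') * (1 + r * s) ^ (δ' - δ)) := by gcongr
      _ = _ := by rw [sub_eq_neg_add, Real.rpow_add hr0]; ring
  rcases le_total δ δ' with h | h
  · rw [min_eq_left h, sub_self, Real.rpow_zero, one_mul]
    refine Real.rpow_le_rpow (by positivity) ?_ (by linarith)
    nlinarith
  · rw [min_eq_right h, ← neg_sub δ' δ, Real.rpow_neg hr0.le, ← Real.inv_rpow hr0.le,
      ← Real.mul_rpow (by positivity) (by positivity)]
    refine Real.rpow_le_rpow_of_nonpos (by positivity) ?_ (by linarith)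
    rw [mul_add, inv_mul_cancel_left₀ hr0.ne', mul_one]
    gcongr
    exact inv_le_one_of_one_le₀ hr

/-! ### The gradient of the distance, and test functions along rays. -/

section Gradient

variable {E : Type*} [NormedAddCommGroup E] [InnerProductSpace ℝ E] [CompleteSpace E]

lemma norm_gradient (f : E → ℝ) (x : E) : ‖gradient f x‖ = ‖fderiv ℝ f x‖ :=
  LinearIsometryEquiv.norm_map _ _

lemma norm_gradient_infDist_le (K : Set E) (x : E) :
    ‖gradient (fun y => Metric.infDist y K) x‖ ≤ 1 := by
  rw [norm_gradient]
  simpa using norm_fderiv_le_of_lipschitz ℝ (Metric.lipschitz_infDist_pt K) (x₀ := x)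

lemma measurable_gradient [MeasurableSpace E] [BorelSpace E] (f : E → ℝ) :
    Measurable (gradient f) := by
  have := measurable_fderiv ℝ f
  exact (InnerProductSpace.toDual ℝ E).symm.continuous.measurable.comp this

lemma continuous_gradient {f : E → ℝ} (hf : ContDiff ℝ 1 f) : Continuous (gradient f) :=
  (InnerProductSpace.toDual ℝ E).symm.continuous.comp (hf.continuous_fderiv one_ne_zero)

variable {K : Set E}

/-- Linear growth along the ray gives `⟪G, v⟫ = D` with `‖v‖ = D`, while `‖G‖ ≤ 1`; the equality
case of Cauchy–Schwarz forces `G = D⁻¹ • v`. -/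
lemma gradient_infDist (hne : K.Nonempty) (hc : IsClosed K) (hK : Convex ℝ K) {x : E} (hx : x ∉ K)
    (hd : DifferentiableAt ℝ (fun y => Metric.infDist y K) x) :
    gradient (fun y => Metric.infDist y K) x =
      (Metric.infDist x K)⁻¹ • (x - convexProj K x) := by
  have hpos : 0 < Metric.infDist x K := (hc.notMem_iff_infDist_pos hne).1 hx
  set D := Metric.infDist x K with hD
  set v := x - convexProj K x with hv
  have hnv : ‖v‖ = D := (infDist_eq_norm_sub_convexProj hne hc hK x).symm
  have h1 : HasDerivAt (fun t : ℝ => Metric.infDist (x + t • v) K)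
      (fderiv ℝ (fun y => Metric.infDist y K) x v) 0 := hd.hasFDerivAt.hasLineDerivAt v
  have h2 : HasDerivAt (fun t : ℝ => (1 + t) * D) D 0 := by
    simpa using ((hasDerivAt_id (0 : ℝ)).const_add 1).mul_const D
  have h3 : fderiv ℝ (fun y => Metric.infDist y K) x v = D := by
    refine h1.unique (h2.congr_of_eventuallyEq ?_)
    filter_upwards [lt_mem_nhds (by norm_num : (-1 : ℝ) < 0)] with t ht
    rw [hD, ← infDist_rayDilation hne hc hK (by linarith : 0 ≤ 1 + t), rayDilation, add_smul,
      one_smul, ← add_assoc, add_sub_cancel]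
  rw [← inner_gradient_left] at h3
  have h4 := norm_gradient_infDist_le K x
  set G := gradient (fun y => Metric.infDist y K) x
  have h5 : ‖G - D⁻¹ • v‖ ^ 2 ≤ 0 := by
    rw [norm_sub_sq_real, inner_smul_right, h3, norm_smul, hnv, norm_inv,
      Real.norm_of_nonneg hpos.le, inv_mul_cancel₀ hpos.ne']
    nlinarith [norm_nonneg G]
  have h6 := pow_eq_zero_iff two_ne_zero |>.1 (le_antisymm h5 (sq_nonneg _))
  exact sub_eq_zero.1 (norm_eq_zero.1 h6)

lemma enorm_div_infDist_le_lintegral (hne : K.Nonempty) (hc : IsClosed K) (hK : Convex ℝ K)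
    {φ : E → ℝ} (hφ : ContDiff ℝ 1 φ) (hs : HasCompactSupport φ) {x : E} (hx : x ∉ K) :
    ‖φ x / Metric.infDist x K‖ₑ ≤ ∫⁻ r in Ioi (1 : ℝ),
      ‖⟪rayDilation K r x - convexProj K (rayDilation K r x), gradient φ (rayDilation K r x)⟫ /
        Metric.infDist (rayDilation K r x) K‖ₑ := by
  have hpos : 0 < Metric.infDist x K := (hc.notMem_iff_infDist_pos hne).1 hx
  set D := Metric.infDist x K with hD
  set v := x - convexProj K x with hv
  have hnv : ‖v‖ = D := (infDist_eq_norm_sub_convexProj hne hc hK x).symm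
  let f : ℝ → ℝ := fun r => φ (rayDilation K r x) / D
  have hf : ContDiff ℝ 1 f := by
    unfold f rayDilation
    fun_prop
  have hderiv : ∀ r, deriv f r = ⟪v, gradient φ (rayDilation K r x)⟫ / D := by
    intro r
    have h1 : HasDerivAt (fun r => rayDilation K r x) v r := by
      simpa [rayDilation] using ((hasDerivAt_id r).smul_const v).const_add (convexProj K x)
    have h2 := (hφ.differentiable one_ne_zero (rayDilation K r x)).hasFDerivAt.comp_hasDerivAt r h1
    rw [inner_gradient_right]
    exact (h2.div_const D).deriv
  obtain ⟨C, hC⟩ := hs.isCompact.isBounded.subset_ball (convexProj K x)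
  -- At ratio `R` the point is at distance `R * D ≥ C` from the projection, hence outside a ball
  -- containing the support.
  set R := max 1 (C / D)
  have hR1 : 1 ≤ R := le_max_left _ _
  have hfR : f R = 0 := by
    have : rayDilation K R x ∉ tsupport φ := by
      intro h
      have h2 := hC h
      rw [mem_ball_iff_norm, rayDilation, add_sub_cancel_left, norm_smul, hnv,
        Real.norm_of_nonneg (by linarith), ← lt_div_iff₀ hpos] at h2
      exact absurd h2 (not_lt.2 (le_max_right _ _))
    simp only [f, image_eq_zero_of_notMem_tsupport this, zero_div]
  have h := enorm_sub_le_lintegral_deriv_of_contDiffOn_Icc hf.contDiffOn hR1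
  rw [hfR, zero_sub, enorm_neg] at h
  simp only [f, rayDilation_one] at h
  rw [← restrict_Ioc_eq_restrict_Icc] at h
  refine h.trans ((lintegral_mono_set Ioc_subset_Ioi_self).trans_eq ?_)
  refine setLIntegral_congr_fun measurableSet_Ioi fun r hr => ?_
  have hr0 : (0 : ℝ) < r := zero_lt_one.trans hr
  -- The unit vector `v / D` is the same at all points of the ray, so the factor `r` cancels.
  rw [hderiv, rayDilation_sub_convexProj hne hc hK hr0.le, infDist_rayDilation hne hc hK hr0.le,
    inner_smul_left, RCLike.conj_to_real, mul_div_mul_left _ _ hr0.ne']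

end Gradient

/-! ### Regularity of the weight and the main theorem. -/

lemma continuous_weight_comp {X : Type*} [TopologicalSpace X] {δ : ℝ} (hδ : 0 ≤ δ) (δ' : ℝ)
    {f : X → ℝ} (hf : Continuous f) (h0 : ∀ x, 0 ≤ f x) :
    Continuous fun x => weight δ δ' (f x) := by
  unfold weight
  exact (hf.rpow_const fun _ => Or.inr hδ).mul
    ((continuous_const.add hf).rpow_const fun x => Or.inl (by linarith [h0 x] : 0 < 1 + f x).ne')

lemma weight_nonneg (δ δ' : ℝ) {s : ℝ} (hs : 0 ≤ s) : 0 ≤ weight δ δ' s :=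
  mul_nonneg (Real.rpow_nonneg hs _) (Real.rpow_nonneg (by linarith) _)

theorem theorem1p1 (d : ℕ) (K Ω : Set (EuclideanSpace ℝ (Fin d)))
    (hK_ne : K.Nonempty) (hK_closed : IsClosed K) (hK_convex : Convex ℝ K) (hΩ : Ω = Kᶜ)
    (δ δ' p a : ℝ) (hδ : 0 ≤ δ) (hδ' : 0 ≤ δ') (hp : 1 ≤ p)
    (hpos : 0 < (d : ℝ) - boundaryDim Ω + min δ δ' - p)
    (ha : a = ((d : ℝ) - boundaryDim Ω + min δ δ' - p) / p)
    (φ : EuclideanSpace ℝ (Fin d) → ℝ) (hφ : IsC1c Ω φ) :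
    MeasureTheory.IntegrableOn
      (fun x => domainWeight δ δ' Ω x * ‖gradient φ x‖ ^ p) Ω ∧
    MeasureTheory.IntegrableOn
      (fun x => domainWeight δ δ' Ω x *
        |inner ℝ (gradient (boundaryDist Ω) x) (gradient φ x)| ^ p) Ω ∧
    MeasureTheory.IntegrableOn
      (fun x => domainWeight δ δ' Ω x * boundaryDist Ω x ^ (-p) * |φ x| ^ p) Ω ∧
    (∫ x in Ω, domainWeight δ δ' Ω x * ‖gradient φ x‖ ^ p) ≥
      (∫ x in Ω, domainWeight δ δ' Ω x *
        |inner ℝ (gradient (boundaryDist Ω) x) (gradient φ x)| ^ p) ∧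
    (∫ x in Ω, domainWeight δ δ' Ω x *
        |inner ℝ (gradient (boundaryDist Ω) x) (gradient φ x)| ^ p) ≥
      a ^ p * ∫ x in Ω, domainWeight δ δ' Ω x * boundaryDist Ω x ^ (-p) * |φ x| ^ p := by
  have hp0 : 0 < p := by linarith
  have hΩc : Ωᶜ = K := by rw [hΩ, compl_compl]
  have hdist : boundaryDist Ω = fun x => Metric.infDist x K := by
    funext x; rw [boundaryDist, hΩc]
  have hΩm : MeasurableSet Ω := hΩ ▸ hK_closed.measurableSet.compl
  have hgrad : Continuous (gradient φ) := continuous_gradient hφ.contDiff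
  have hd0 : ∀ x, 0 ≤ Metric.infDist x K := fun x => Metric.infDist_nonneg
  have hdcont : Continuous fun x => Metric.infDist x K := Metric.continuous_infDist_pt K
  have hdpos : ∀ x ∈ Ω, 0 < Metric.infDist x K := fun x hx =>
    (hK_closed.notMem_iff_infDist_pos hK_ne).1 (by rwa [hΩ] at hx)
  have hwc : Continuous fun x => weight δ δ' (Metric.infDist x K) :=
    continuous_weight_comp hδ δ' hdcont hd0
  have hw0 : ∀ x, 0 ≤ weight δ δ' (Metric.infDist x K) := fun x => weight_nonneg δ δ' (hd0 x)
  have hle : ∀ x, weight δ δ' (Metric.infDist x K) *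
      |inner ℝ (gradient (fun x => Metric.infDist x K) x) (gradient φ x)| ^ p ≤
      weight δ δ' (Metric.infDist x K) * ‖gradient φ x‖ ^ p := fun x => by
    have h1 := hw0 x
    gcongr
    refine (abs_real_inner_le_norm _ _).trans ?_
    exact mul_le_of_le_one_left (norm_nonneg _) (norm_gradient_infDist_le K x)
  simp only [domainWeight, hdist]
  have int1 : IntegrableOn
      (fun x => weight δ δ' (Metric.infDist x K) * ‖gradient φ x‖ ^ p) Ω := by
    refine (Continuous.integrable_of_hasCompactSupport ?_ ?_).integrableOn
    · exact hwc.mul (hgrad.norm.rpow_const fun _ => Or.inr hp0.le)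
    · refine HasCompactSupport.mul_left (hφ.hasCompactSupport.fderiv ℝ |>.mono fun x hx h => hx ?_)
      simp only [norm_gradient, h, norm_zero, Real.zero_rpow hp0.ne']
  have int2 : IntegrableOn (fun x => weight δ δ' (Metric.infDist x K) *
      |inner ℝ (gradient (fun x => Metric.infDist x K) x) (gradient φ x)| ^ p) Ω := by
    refine int1.mono' ?_ (Eventually.of_forall fun x => ?_)
    · have h1 := measurable_gradient fun x => Metric.infDist x K
      have h2 := hgrad.measurable
      have h3 := hwc.measurable
      have h4 := h1.inner h2 (𝕜 := ℝ)
      exact (h3.mul ((h4.abs).pow_const p)).aestronglyMeasurable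
    · rw [Real.norm_of_nonneg (mul_nonneg (hw0 x) (by positivity))]
      exact hle x
  have int3 : IntegrableOn (fun x => weight δ δ' (Metric.infDist x K) *
      Metric.infDist x K ^ (-p) * |φ x| ^ p) Ω := by
    -- The power `-p` of the distance may blow up at the boundary; on the compact support of `φ` the
    -- distance is positive and the integrand continuous.
    refine IntegrableOn.of_forall_sdiff_eq_zero (s := tsupport φ) ?_ hΩm fun x hx => ?_
    · refine ContinuousOn.integrableOn_compact hφ.hasCompactSupport.isCompact ?_
      refine (hwc.continuousOn.mul (hdcont.continuousOn.rpow_const fun x hx =>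
        Or.inl (hdpos x (hφ.tsupport_subset hx)).ne')).mul ?_
      exact (hφ.contDiff.continuous.abs.rpow_const fun _ => Or.inr hp0.le).continuousOn
    · rw [image_eq_zero_of_notMem_tsupport hx.2, abs_zero, Real.zero_rpow hp0.ne', mul_zero]
  refine ⟨int1, int2, int3, setIntegral_mono int2 int1 hle, ?_⟩
  by_cases hu : K = univ
  · have : Ω = ∅ := by rw [hΩ, hu, compl_univ]
    simp [this]
  obtain ⟨m, hm, hdir⟩ := exists_codim_directions hK_ne hK_closed hK_convex hu
  have ha0 : 0 < a := ha ▸ div_pos hpos hp0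
  have hκ : (1 + a) * p ≤ m + min δ δ' := by
    have h1 : a * p = (d : ℝ) - boundaryDim Ω + min δ δ' - p := by
      rw [ha, div_mul_cancel₀ _ hp0.ne']
    rw [finrank_euclideanSpace_fin, ← frontier_compl K, ← hΩ] at hm
    rw [boundaryDim] at h1
    linarith
  have hPc := continuous_convexProj hK_ne hK_closed hK_convex
  -- Here `g` is `|∇d_Γ·∇φ|` written with the projection, so that the ray bound holds at every
  -- point; `e2` identifies the two almost everywhere, by Rademacher.
  have key := lintegral_hardy_rays volume hK_ne hK_closed hK_convex hdir ha0 hp hκ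
    (w := fun x => ENNReal.ofReal (weight δ δ' (Metric.infDist x K)))
    (g := fun x => ‖inner ℝ (x - convexProj K x) (gradient φ x) / Metric.infDist x K‖ₑ)
    (F := fun x => ‖φ x / Metric.infDist x K‖ₑ)
    hwc.measurable.ennreal_ofReal
    (((continuous_id.sub hPc).inner hgrad).measurable.div hdcont.measurable).enorm
    (fun x r hr => by
      rw [← ENNReal.ofReal_mul (by positivity),
        infDist_rayDilation hK_ne hK_closed hK_convex (by linarith)]
      exact ENNReal.ofReal_le_ofReal (weight_le_rpow_mul_weight hr (hd0 x)))
    (fun x hx => enorm_div_infDist_le_lintegral hK_ne hK_closed hK_convex hφ.contDiff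
      hφ.hasCompactSupport hx)
  rw [← hΩ] at key
  have e3 : ∫⁻ x in Ω, ENNReal.ofReal (weight δ δ' (Metric.infDist x K)) *
      ‖φ x / Metric.infDist x K‖ₑ ^ p = ENNReal.ofReal (∫ x in Ω,
        weight δ δ' (Metric.infDist x K) * Metric.infDist x K ^ (-p) * |φ x| ^ p) := by
    rw [ofReal_integral_eq_lintegral_ofReal int3 (Eventually.of_forall fun x =>
      mul_nonneg (mul_nonneg (hw0 x) (Real.rpow_nonneg (hd0 x) _)) (by positivity))]
    refine setLIntegral_congr_fun hΩm fun x hx => ?_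
    rw [← ofReal_norm, ENNReal.ofReal_rpow_of_nonneg (norm_nonneg _) hp0.le,
      ← ENNReal.ofReal_mul (hw0 x), norm_div, Real.norm_of_nonneg (hd0 x), Real.norm_eq_abs,
      Real.div_rpow (abs_nonneg _) (hd0 x), Real.rpow_neg (hd0 x)]
    ring_nf
  have e2 : ∫⁻ x in Ω, ENNReal.ofReal (weight δ δ' (Metric.infDist x K)) *
      ‖inner ℝ (x - convexProj K x) (gradient φ x) / Metric.infDist x K‖ₑ ^ p =
      ENNReal.ofReal (∫ x in Ω, weight δ δ' (Metric.infDist x K) *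
        |inner ℝ (gradient (fun x => Metric.infDist x K) x) (gradient φ x)| ^ p) := by
    rw [ofReal_integral_eq_lintegral_ofReal int2 (Eventually.of_forall fun x =>
      mul_nonneg (hw0 x) (by positivity))]
    refine lintegral_congr_ae ?_
    filter_upwards [self_mem_ae_restrict hΩm, ae_restrict_of_ae
      ((Metric.lipschitz_infDist_pt K).ae_differentiableAt (μ := volume))] with x hx hdx
    rw [gradient_infDist hK_ne hK_closed hK_convex (by rwa [hΩ] at hx) hdx, inner_smul_left,
      RCLike.conj_to_real, inv_mul_eq_div, ← Real.norm_eq_abs, ENNReal.ofReal_mul (hw0 x),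
      ← ENNReal.ofReal_rpow_of_nonneg (norm_nonneg _) hp0.le, ofReal_norm]
  have hI2 : 0 ≤ ∫ x in Ω, weight δ δ' (Metric.infDist x K) *
        |inner ℝ (gradient (fun x => Metric.infDist x K) x) (gradient φ x)| ^ p :=
    integral_nonneg fun x => mul_nonneg (hw0 x) (by positivity)
  rw [e2, e3, ← ENNReal.ofReal_mul (by positivity), ENNReal.ofReal_le_ofReal_iff (by positivity),
    Real.rpow_neg ha0.le, inv_mul_eq_div, le_div_iff₀ (by positivity), mul_comm] at key
  exact key
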